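/- Let $d\ge 1$, let $X$ be a random variable with values in $[0,1]^d$ that has a density with respect to Lebesgue measure, and let $Y$ be a square integrable real random variable on the same probability space. Fix $0<q<1$. For a Borel set $A\subseteq\mathbb{R}^d$ put $\alpha(A)=\mathbb{E}[Y\mid X\in A]$ (any convention, say $0$, if $\mathbb{P}(X\in A)=0$). The idealized (infinite-sample) regression tree is built as follows. The root cell is the box $[0,1)^d$. Each cell $Q=\prod_{i}[a(i),b(i))$ at depth $k$ is split, in a direction $j$ and at a threshold $t\in[a(j),b(j)]$, into the two cells $\{x\in Q: x_j<t\}$ and $\{x\in Q: x_j\ge t\}$ of depth $k+1$ (one of which may be empty). The direction $j$ is uniform on $\{1,\dots,d\}$ and, independently of it, with probability $q$ the threshold is the midpoint $t=(a(j)+b(j))/2$, and with probability $1-q$ it is a minimizer over $t\in[a(j),b(j)]$ of the mean square error $$\mathbb{E}\Big[\big(\alpha(Q\cap\{x_j<t\})\mathbf 1_{\{X_j<t\}}+\alpha(Q\cap\{x_j\ge t\})\mathbf 1_{\{X_j\ge t\}}-Y\big)^2\mathbf 1_{\{X\in Q\}}\Big],$$ ties being broken by an arbitrary fixed (deterministic)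 rule, which may depend on the node of the tree, the cell and the direction. The family of all random choices (direction; midpoint or optimal) is independent of $(X,Y)$, and the choices made along each infinite branch of the tree are independent. (This covers both independent choices at all nodes, and independent choices at the successive levels that are shared by all nodes of a level.) There is no early stopping, so the tree of depth $p$ has $2^p$ leaves $Q_p^1,\dots,Q_p^{2^p}$, and $$\mathcal{T}_p(X)=\sum_{i=1}^{2^p}\alpha(Q_p^i)\,\mathbf 1_{\{X\in Q_p^i\}},$$ where $\alpha(Q_p^i)$ is computed for the realized cell $Q_p^i$, that is, with the random choices held fixed. Then $\mathcal{T}_p(X)$ is square integrable for every $p$, and $$\lim_{p\to\infty}\mathbb{E}\left[\big|\mathcal{T}_p(X)-\mathbb{E}[Y\mid X]\big|^2\right]=0 .$$ -/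

import Mathlib

open MeasureTheory ProbabilityTheory Filter Topology

noncomputable section

namespace RegTree

/-- The two corners of a box in `ℝ^d`. -/
@[ext] structure Box (d : ℕ) where
  lo : Fin d → ℝ
  hi : Fin d → ℝ

namespace Box

variable {d : ℕ}

/-- The half-open box `∏ i, [lo i, hi i)`. -/
def toSet (Q : Box d) : Set (Fin d → ℝ) := Set.pi Set.univ fun i => Set.Ico (Q.lo i) (Q.hi i)

/-- The unit cube, the root cell. -/
def unit (d : ℕ) : Box d := ⟨fun _ => 0, fun _ => 1⟩

/-- The part of the box below the threshold `t` in direction `j`. -/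
def left (Q : Box d) (j : Fin d) (t : ℝ) : Box d := ⟨Q.lo, Function.update Q.hi j t⟩

/-- The part of the box above the threshold `t` in direction `j`. -/
def right (Q : Box d) (j : Fin d) (t : ℝ) : Box d := ⟨Function.update Q.lo j t, Q.hi⟩

/-- The midpoint of the side of the box in direction `j`. -/
def mid (Q : Box d) (j : Fin d) : ℝ := (Q.lo j + Q.hi j) / 2

end Box

section Tree

variable {Ω : Type*} [MeasurableSpace Ω] {d : ℕ}

/-- `E[Y | X ∈ A]`, the elementary conditional expectation given the event `X ∈ A`
(with value `0` if this event is null). -/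
def cellMean (P : Measure Ω) (X : Ω → Fin d → ℝ) (Y : Ω → ℝ) (A : Set (Fin d → ℝ)) : ℝ :=
  ⨍ ω in X ⁻¹' A, Y ω ∂P

/-- Mean square error on the cell `Q` when `Q` is split in direction `j` at the threshold `t`
and `Y` is predicted on each of the two parts by its conditional mean there. -/
def splitMSE (P : Measure Ω) (X : Ω → Fin d → ℝ) (Y : Ω → ℝ) (Q : Box d) (j : Fin d) (t : ℝ) : ℝ :=
  ∫ ω in X ⁻¹' Q.toSet,
    ((if X ω j < t then cellMean P X Y (Q.left j t).toSet
      else cellMean P X Y (Q.right j t).toSet) - Y ω) ^ 2 ∂P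

/-- `opt v Q j` is, for each node `v`, each box `Q` and each direction `j`, a threshold in
`[Q.lo j, Q.hi j]` that minimizes the mean square error of the split. Nodes are lists of
left / right turns; a minimizer need not be unique, and `opt` says which one is used. -/
def IsOptimalRule (P : Measure Ω) (X : Ω → Fin d → ℝ) (Y : Ω → ℝ)
    (opt : List Bool → Box d → Fin d → ℝ) : Prop :=
  ∀ (v : List Bool) (Q : Box d) (j : Fin d), Q.lo ≤ Q.hi →
    opt v Q j ∈ Set.Icc (Q.lo j) (Q.hi j) ∧
      ∀ t ∈ Set.Icc (Q.lo j) (Q.hi j),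
        splitMSE P X Y Q j (opt v Q j) ≤ splitMSE P X Y Q j t

/-- The cell of the node `v`. A node of depth `p` is the list of the `p` turns that lead to it
from the root, the last turn first (`false`: left, `true`: right). `s v` is the choice made
for the split of the node `v`: its direction, and whether the threshold is the midpoint (`true`)
or optimal (`false`). -/
def cell (opt : List Bool → Box d → Fin d → ℝ) (s : List Bool → Fin d × Bool) :
    List Bool → Box d
  | [] => Box.unit d
  | turn :: v =>
    let Q := cell opt s v
    let j := (s v).1
    let t := if (s v).2 then Q.mid j else opt v Q j
    if turn then Q.right j t else Q.left j t

/-- The regression tree of depth `p` built with the choices `s`, as a function on the cube: the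
sum over its `2 ^ p` leaves of the conditional mean of `Y` on the leaf times the indicator of
the leaf. -/
def tree (P : Measure Ω) (X : Ω → Fin d → ℝ) (Y : Ω → ℝ)
    (opt : List Bool → Box d → Fin d → ℝ) (p : ℕ) (s : List Bool → Fin d × Bool)
    (x : Fin d → ℝ) : ℝ :=
  ∑ v : Fin p → Bool,
    (cell opt s (List.ofFn v)).toSet.indicator
      (fun _ => cellMean P X Y (cell opt s (List.ofFn v)).toSet) x

/-- The node at depth `k` on the infinite branch with the turns `b 0, b 1, …`. -/
def branch (b : ℕ → Bool) : ℕ → List Bool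
  | 0 => []
  | k + 1 => b k :: branch b k

/-- Random choices for the splits: at each node the direction is uniform on the `d` directions
and, independently of it, the threshold is the midpoint with probability `q` and optimal with
probability `1 - q`; the choices made along each branch of the tree are independent. This holds
both when the choices at all nodes are independent, and when independent choices are made for
the successive levels and shared by all nodes of a level. -/
structure IsSplittingStrategy (P : Measure Ω) (q : ℝ) (S : List Bool → Ω → Fin d × Bool) :
    Prop where
  measurable : ∀ v, Measurable (S v)
  prob_mid : ∀ v j, P.real {ω | S v ω = (j, true)} = q / d
  prob_opt : ∀ v j, P.real {ω | S v ω = (j, false)} = (1 - q) / d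
  indep : ∀ b : ℕ → Bool, iIndepFun (fun k => S (branch b k)) P

end Tree

end RegTree

end

/-! Write `E[Y | X] = f(X)`, let `μ` be the law of `X` and `ν` that of the choices. The cell means
of `Y` are those of `f` under `μ`, and by independence the pair (choices, `X`) has law `ν × μ`, so
the claim becomes `L²(ν × μ)` convergence of the cell averages of `f` to `f`.

For fixed choices, averaging over disjoint cells is a linear `L²(μ)` contraction
(`lintegral_tree_sq_le`), which reduces the problem to a continuous, compactly supported `g`.
Uniform continuity makes the error for `g` small wherever the cell is small; elsewhere `g` is
bounded, and a Markov bound controls the large cells by their expected sides.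

Those sides decay (`lintegral_leafSide_le`): a midpoint split in direction `j`, of probability
`q/d`, halves side `j`, and every other split is credited only with not lengthening it. The choice
at a node is independent of its cell, so each level contributes a factor `1 - q/(2d)`. -/

noncomputable section

namespace RegTree

open scoped ENNReal

/-! ### Cells as a nested partition of the cube; side lengths. -/

section Geometry

variable {d : ℕ} {opt : List Bool → Box d → Fin d → ℝ} {s : List Bool → Fin d × Bool}

lemma Box.mem_toSet {Q : Box d} {x : Fin d → ℝ} :
    x ∈ Q.toSet ↔ ∀ i, Q.lo i ≤ x i ∧ x i < Q.hi i := by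
  simp [Box.toSet, Set.mem_pi]

lemma Box.measurableSet_toSet (Q : Box d) : MeasurableSet Q.toSet :=
  MeasurableSet.univ_pi fun _ => measurableSet_Ico

/-- The rule `opt` always picks a threshold in the side that is split. -/
def IsAdmissible (opt : List Bool → Box d → Fin d → ℝ) : Prop :=
  ∀ v Q j, Q.lo ≤ Q.hi → opt v Q j ∈ Set.Icc (Q.lo j) (Q.hi j)

/-- The threshold used at the node `v` when the cell there is `Q` and the choice made is `c`. -/
def threshold (opt : List Bool → Box d → Fin d → ℝ) (v : List Bool) (Q : Box d)
    (c : Fin d × Bool) : ℝ :=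
  if c.2 then Q.mid c.1 else opt v Q c.1

/-- The child of the cell `Q` at the node `v` for the choice `c` and the given turn. -/
def child (opt : List Bool → Box d → Fin d → ℝ) (turn : Bool) (v : List Bool) (Q : Box d)
    (c : Fin d × Bool) : Box d :=
  if turn then Q.right c.1 (threshold opt v Q c) else Q.left c.1 (threshold opt v Q c)

lemma cell_cons (turn : Bool) (v : List Bool) :
    cell opt s (turn :: v) = child opt turn v (cell opt s v) (s v) := rfl

lemma threshold_mem (hopt : IsAdmissible opt) {v : List Bool} {Q : Box d} (hQ : Q.lo ≤ Q.hi)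
    (c : Fin d × Bool) : threshold opt v Q c ∈ Set.Icc (Q.lo c.1) (Q.hi c.1) := by
  unfold threshold
  split_ifs
  · have := hQ c.1
    simp only [Box.mid, Set.mem_Icc]
    constructor <;> linarith
  · exact hopt v Q c.1 hQ

lemma child_lo_le_hi (hopt : IsAdmissible opt) (turn : Bool) {v : List Bool} {Q : Box d}
    (hQ : Q.lo ≤ Q.hi) (c : Fin d × Bool) :
    (child opt turn v Q c).lo ≤ (child opt turn v Q c).hi := by
  intro i
  have h := threshold_mem hopt (v := v) hQ c
  have hi := hQ i
  rcases eq_or_ne i c.1 with rfl | hne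
  · cases turn <;> simp [child, Box.left, Box.right, h.1, h.2]
  · cases turn <;> simp [child, Box.left, Box.right, hne, hi]

lemma cell_lo_le_hi (hopt : IsAdmissible opt) (s : List Bool → Fin d × Bool) (v : List Bool) :
    (cell opt s v).lo ≤ (cell opt s v).hi := by
  induction v with
  | nil => intro i; simp [cell, Box.unit]
  | cons turn v ih => exact child_lo_le_hi hopt turn ih (s v)

lemma mem_child_iff (hopt : IsAdmissible opt) (turn : Bool) {v : List Bool} {Q : Box d}
    (hQ : Q.lo ≤ Q.hi) (c : Fin d × Bool) (x : Fin d → ℝ) :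
    x ∈ (child opt turn v Q c).toSet ↔
      x ∈ Q.toSet ∧ turn = decide (threshold opt v Q c ≤ x c.1) := by
  have h := threshold_mem hopt (v := v) hQ c
  set t := threshold opt v Q c with ht
  cases turn
  · simp only [child, ← ht, Box.mem_toSet, Box.left, Bool.false_eq_true, if_false]
    rw [eq_comm, decide_eq_false_iff_not, not_le]
    constructor
    · intro hx
      have hc := (hx c.1).2
      rw [Function.update_self] at hc
      refine ⟨fun i => ⟨(hx i).1, ?_⟩, hc⟩
      rcases eq_or_ne i c.1 with rfl | hne
      · exact hc.trans_le h.2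
      · simpa [hne] using (hx i).2
    · rintro ⟨hx, hc⟩ i
      refine ⟨(hx i).1, ?_⟩
      rcases eq_or_ne i c.1 with rfl | hne
      · simpa using hc
      · simpa [hne] using (hx i).2
  · simp only [child, ← ht, Box.mem_toSet, Box.right, if_true]
    rw [eq_comm, decide_eq_true_iff]
    constructor
    · intro hx
      have hc := (hx c.1).1
      rw [Function.update_self] at hc
      refine ⟨fun i => ⟨?_, (hx i).2⟩, hc⟩
      rcases eq_or_ne i c.1 with rfl | hne
      · exact h.1.trans hc
      · simpa [hne] using (hx i).1
    · rintro ⟨hx, hc⟩ i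
      refine ⟨?_, (hx i).2⟩
      rcases eq_or_ne i c.1 with rfl | hne
      · simpa using hc
      · simpa [hne] using (hx i).1

/-- The node of depth `p` whose cell contains `x`. -/
def leaf (opt : List Bool → Box d → Fin d → ℝ) (s : List Bool → Fin d × Bool) (x : Fin d → ℝ) :
    ℕ → List Bool
  | 0 => []
  | p + 1 =>
    decide (threshold opt (leaf opt s x p) (cell opt s (leaf opt s x p)) (s (leaf opt s x p))
      ≤ x (s (leaf opt s x p)).1) :: leaf opt s x p

lemma length_leaf (x : Fin d → ℝ) (p : ℕ) : (leaf opt s x p).length = p := by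
  induction p with
  | zero => rfl
  | succ p ih => simp [leaf, ih]

/-- At each node exactly one turn keeps `x` in the cell, so the path to `x` is forced. Covering and
disjointness of the leaves both follow. -/
lemma mem_cell_iff (hopt : IsAdmissible opt) {x : Fin d → ℝ} (v : List Bool) :
    x ∈ (cell opt s v).toSet ↔ x ∈ (Box.unit d).toSet ∧ v = leaf opt s x v.length := by
  induction v with
  | nil => simp [cell, leaf]
  | cons turn v ih =>
    rw [cell_cons, mem_child_iff hopt turn (cell_lo_le_hi hopt s v), ih]
    simp only [List.length_cons, leaf, List.cons.injEq]
    constructor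
    · rintro ⟨⟨h1, h2⟩, h3⟩
      rw [← h2]
      exact ⟨h1, h3, rfl⟩
    · rintro ⟨h1, h2, h3⟩
      rw [← h3] at h2
      exact ⟨⟨h1, h3⟩, h2⟩

lemma exists_mem_cell (hopt : IsAdmissible opt) {x : Fin d → ℝ} (hx : x ∈ (Box.unit d).toSet)
    (p : ℕ) : ∃ v : Fin p → Bool, x ∈ (cell opt s (List.ofFn v)).toSet := by
  refine ⟨fun i => (leaf opt s x p).get (i.cast (length_leaf x p).symm), ?_⟩
  have : List.ofFn (fun i : Fin p => (leaf opt s x p).get (i.cast (length_leaf x p).symm))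
      = leaf opt s x p := by
    apply List.ext_get <;> simp [length_leaf]
  rw [this, mem_cell_iff hopt, length_leaf]
  exact ⟨hx, rfl⟩

lemma pairwise_disjoint_cell (hopt : IsAdmissible opt) (s : List Bool → Fin d × Bool) (p : ℕ) :
    Pairwise fun v w : Fin p → Bool =>
      Disjoint (cell opt s (List.ofFn v)).toSet (cell opt s (List.ofFn w)).toSet := by
  intro v w hvw
  rw [Set.disjoint_left]
  intro x hv hw
  rw [mem_cell_iff hopt, List.length_ofFn] at hv hw
  exact hvw (List.ofFn_injective (hv.2.trans hw.2.symm))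

/-- The length of the side of a box in direction `j`. -/
def Box.side (Q : Box d) (j : Fin d) : ℝ := Q.hi j - Q.lo j

/-- The factor by which a split with the choice `c` is sure to shrink the side in direction `j`:
one half for a midpoint split in this direction. -/
def shrink (j : Fin d) (c : Fin d × Bool) : ℝ≥0∞ := if c = (j, true) then 2⁻¹ else 1

lemma side_child_le (hopt : IsAdmissible opt) (turn : Bool) {v : List Bool} {Q : Box d}
    (hQ : Q.lo ≤ Q.hi) (c : Fin d × Bool) (j : Fin d) :
    ENNReal.ofReal ((child opt turn v Q c).side j) ≤ ENNReal.ofReal (Q.side j) * shrink j c := by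
  have h := threshold_mem hopt (v := v) hQ c
  unfold shrink
  split_ifs with hc
  · subst hc
    have : (2⁻¹ : ℝ≥0∞) = ENNReal.ofReal 2⁻¹ := by
      rw [ENNReal.ofReal_inv_of_pos two_pos, ENNReal.ofReal_ofNat]
    rw [this, ← ENNReal.ofReal_mul' (by norm_num)]
    apply ENNReal.ofReal_le_ofReal
    cases turn <;> simp [child, Box.left, Box.right, Box.side, threshold, Box.mid] <;> linarith
  · rw [mul_one]
    apply ENNReal.ofReal_le_ofReal
    rcases eq_or_ne j c.1 with rfl | hne
    · cases turn <;> simp [child, Box.left, Box.right, Box.side]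
      · exact h.2
      · linarith [h.1]
    · cases turn <;> simp [child, Box.left, Box.right, Box.side, hne]

lemma dist_lt_of_mem_toSet {Q : Box d} {δ : ℝ} (hδ : 0 < δ) (hQ : ∀ j, Q.side j ≤ δ)
    {x y : Fin d → ℝ} (hx : x ∈ Q.toSet) (hy : y ∈ Q.toSet) : dist x y < δ := by
  rw [dist_pi_lt_iff hδ]
  intro j
  rw [Box.mem_toSet] at hx hy
  have := hQ j
  have h1 := hx j
  have h2 := hy j
  unfold Box.side at this
  rw [Real.dist_eq, abs_lt]
  constructor <;> linarith

end Geometry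

/-! ### Measurability in the choices, and dependence on ancestors only. -/

section Measurability

variable {d : ℕ} {opt : List Bool → Box d → Fin d → ℝ}

/-- Every set of boxes is measurable: the random cells take only finitely many values. -/
instance Box.instMeasurableSpace : MeasurableSpace (Box d) := ⊤

lemma measurable_cell (opt : List Bool → Box d → Fin d → ℝ) (v : List Bool) :
    Measurable fun s : List Bool → Fin d × Bool => cell opt s v := by
  induction v with
  | nil => exact measurable_const
  | cons turn v ih =>
    -- Joint measurability with the discrete σ-algebra on boxes holds because the other factor is
    -- countable.
    have : Measurable fun z : Box d × (Fin d × Bool) => child opt turn v z.1 z.2 :=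
      measurable_from_prod_countable_left fun c => measurable_from_top
    exact this.comp (ih.prodMk (measurable_pi_apply v))

lemma measurableSet_mem_cell (opt : List Bool → Box d → Fin d → ℝ) (v : List Bool) :
    MeasurableSet {z : (List Bool → Fin d × Bool) × (Fin d → ℝ) |
      z.2 ∈ (cell opt z.1 v).toSet} := by
  have hc : Measurable fun z : (List Bool → Fin d × Bool) × (Fin d → ℝ) => cell opt z.1 v :=
    (measurable_cell opt v).comp measurable_fst
  simp only [Box.mem_toSet, Set.ofPred_forall, Set.ofPred_and]
  refine MeasurableSet.iInter fun i => MeasurableSet.inter ?_ ?_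
  · exact measurableSet_le ((measurable_from_top (f := fun Q : Box d => Q.lo i)).comp hc)
      ((measurable_pi_apply i).comp measurable_snd)
  · exact measurableSet_lt ((measurable_pi_apply i).comp measurable_snd)
      ((measurable_from_top (f := fun Q : Box d => Q.hi i)).comp hc)

lemma measurable_indicator_cell {β : Type*} [MeasurableSpace β] [Zero β] (v : List Bool)
    (f : Box d → β) :
    Measurable fun z : (List Bool → Fin d × Bool) × (Fin d → ℝ) =>
      (cell opt z.1 v).toSet.indicator (fun _ => f (cell opt z.1 v)) z.2 := by
  have hc : Measurable fun z : (List Bool → Fin d × Bool) × (Fin d → ℝ) => cell opt z.1 v :=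
    (measurable_cell opt v).comp measurable_fst
  exact ((measurable_from_top (f := f)).comp hc).indicator (measurableSet_mem_cell opt v)

lemma measurable_tree {Ω : Type*} [MeasurableSpace Ω] (P : Measure Ω) (X : Ω → Fin d → ℝ)
    (Y : Ω → ℝ) (p : ℕ) :
    Measurable fun z : (List Bool → Fin d × Bool) × (Fin d → ℝ) =>
      tree P X Y opt p z.1 z.2 :=
  Finset.measurable_sum _ fun v _ =>
    measurable_indicator_cell (List.ofFn v) fun Q => cellMean P X Y Q.toSet

lemma cell_congr {s s' : List Bool → Fin d × Bool} (b : ℕ → Bool) (p : ℕ)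
    (h : ∀ k < p, s (branch b k) = s' (branch b k)) :
    cell opt s (branch b p) = cell opt s' (branch b p) := by
  induction p with
  | zero => rfl
  | succ p ih =>
    rw [branch, cell_cons, cell_cons, ih fun k hk => h k (hk.trans p.lt_succ_self),
      h p p.lt_succ_self]

lemma length_branch (b : ℕ → Bool) (p : ℕ) : (branch b p).length = p := by
  induction p with
  | zero => rfl
  | succ p ih => simp [branch, ih]

/-- Independence is assumed along infinite branches, so each node has to be placed on one. Nodes
list the last turn first, hence the reversal. -/
lemma exists_branch_eq (v : List Bool) : ∃ b : ℕ → Bool, branch b v.length = v := by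
  refine ⟨fun k => v.reverse.getD k false, ?_⟩
  have key : ∀ (w : List Bool) (b : ℕ → Bool), (∀ k < w.length, b k = w.reverse.getD k false) →
      branch b w.length = w := by
    intro w
    induction w with
    | nil => intro b _; rfl
    | cons a w ih =>
      intro b hb
      rw [List.length_cons, branch, ih b, hb w.length (by simp)]
      · simp
      · intro k hk
        rw [hb k (by simp; omega), List.reverse_cons, List.getD_append _ _ _ _ (by simpa using hk)]
  exact key v _ fun _ _ => rfl

end Measurability

/-! ### Geometric decay of the expected side lengths. -/

section Shrinking

variable {d : ℕ} {opt : List Bool → Box d → Fin d → ℝ}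

/-- The length of the side of `Q` in direction `j` if `x` lies in `Q`, and `0` otherwise. -/
def sideAt (j : Fin d) (Q : Box d) (x : Fin d → ℝ) : ℝ≥0∞ :=
  Q.toSet.indicator (fun _ => ENNReal.ofReal (Q.side j)) x

/-- The length in direction `j` of the cell of depth `p` that contains `x`. -/
def leafSide (opt : List Bool → Box d → Fin d → ℝ) (j : Fin d) (p : ℕ)
    (s : List Bool → Fin d × Bool) (x : Fin d → ℝ) : ℝ≥0∞ :=
  ∑ v : Fin p → Bool, sideAt j (cell opt s (List.ofFn v)) x

lemma measurable_leafSide (j : Fin d) (p : ℕ) :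
    Measurable fun z : (List Bool → Fin d × Bool) × (Fin d → ℝ) =>
      leafSide opt j p z.1 z.2 :=
  Finset.measurable_sum _ fun v _ =>
    measurable_indicator_cell (List.ofFn v) fun Q => ENNReal.ofReal (Q.side j)

lemma measurable_leafSide_left (j : Fin d) (p : ℕ) (x : Fin d → ℝ) :
    Measurable fun s : List Bool → Fin d × Bool => leafSide opt j p s x :=
  Finset.measurable_sum _ fun v _ =>
    (measurable_from_top (f := fun Q => sideAt j Q x)).comp (measurable_cell opt (List.ofFn v))

lemma sideAt_le_leafSide {s : List Bool → Fin d × Bool} (j : Fin d) {p : ℕ} (v : Fin p → Bool)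
    (x : Fin d → ℝ) : sideAt j (cell opt s (List.ofFn v)) x ≤ leafSide opt j p s x :=
  Finset.single_le_sum (f := fun v : Fin p → Bool => sideAt j (cell opt s (List.ofFn v)) x)
    (fun _ _ => zero_le) (Finset.mem_univ v)

/-- The children partition the cell, so at most one term on the left is nonzero. -/
lemma sideAt_children_le (hopt : IsAdmissible opt) {v : List Bool} {Q : Box d}
    (hQ : Q.lo ≤ Q.hi) (c : Fin d × Bool) (j : Fin d) (x : Fin d → ℝ) :
    sideAt j (child opt true v Q c) x + sideAt j (child opt false v Q c) x
      ≤ sideAt j Q x * shrink j c := by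
  unfold sideAt
  have hmem := fun turn => mem_child_iff hopt turn (v := v) hQ c x
  have hside := fun turn => side_child_le hopt turn (v := v) hQ c j
  by_cases hx : x ∈ Q.toSet
  · by_cases ht : threshold opt v Q c ≤ x c.1
    · rw [Set.indicator_of_mem ((hmem true).2 ⟨hx, by simp [ht]⟩), Set.indicator_of_mem hx,
        Set.indicator_of_notMem (fun h => by simpa [ht] using ((hmem false).1 h).2), add_zero]
      exact hside true
    · rw [Set.indicator_of_mem ((hmem false).2 ⟨hx, by simp [ht]⟩), Set.indicator_of_mem hx,
        Set.indicator_of_notMem (fun h => by simpa [ht] using ((hmem true).1 h).2), zero_add]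
      exact hside false
  · rw [Set.indicator_of_notMem fun h => hx ((hmem true).1 h).1,
      Set.indicator_of_notMem fun h => hx ((hmem false).1 h).1]
    simp

lemma leafSide_zero_le (j : Fin d) (s : List Bool → Fin d × Bool) (x : Fin d → ℝ) :
    leafSide opt j 0 s x ≤ 1 := by
  simp only [leafSide, Finset.univ_unique, Finset.sum_singleton, List.ofFn_zero, cell, sideAt]
  refine (Set.indicator_le_self _ _ _).trans ?_
  simp [Box.side, Box.unit]

/-- The leaf containing `x` is random; summing over all nodes leaves only choices at deterministic
nodes, where independence is available. -/
lemma leafSide_succ_le (hopt : IsAdmissible opt) (j : Fin d) (p : ℕ)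
    (s : List Bool → Fin d × Bool) (x : Fin d → ℝ) :
    leafSide opt j (p + 1) s x ≤ ∑ v : Fin p → Bool,
      sideAt j (cell opt s (List.ofFn v)) x * shrink j (s (List.ofFn v)) := by
  unfold leafSide
  rw [← (Fin.consEquiv fun _ => Bool).sum_comp, Fintype.sum_prod_type_right]
  refine Finset.sum_le_sum fun v _ => ?_
  simpa [Fin.consEquiv, List.ofFn_succ, cell_cons] using
    sideAt_children_le hopt (cell_lo_le_hi hopt s (List.ofFn v)) (s (List.ofFn v)) j x

variable {Ω : Type*} [MeasurableSpace Ω] {P : Measure Ω} [IsProbabilityMeasure P] {q : ℝ}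
  {S : List Bool → Ω → Fin d × Bool}

/-- On a branch through `v`, the cell is a function of the choices at levels below `p`, while `S v`
is the choice at level `p`. -/
lemma IsSplittingStrategy.indepFun_cell (hS : IsSplittingStrategy P q S)
    (opt : List Bool → Box d → Fin d → ℝ) (v : List Bool) :
    IndepFun (fun ω => cell opt (fun w => S w ω) v) (S v) P := by
  obtain ⟨b, hb⟩ := exists_branch_eq v
  set p := v.length
  rw [← hb]
  have h := (hS.indep b).indepFun_finset (Finset.range p) {p} (by simp)
    fun k => hS.measurable (branch b k)
  -- the choices off the branch are irrelevant
  let extend : Fin d × Bool → (Finset.range p → Fin d × Bool) → List Bool → Fin d × Bool :=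
    fun c t w => if hw : w.length ∈ Finset.range p then t ⟨w.length, hw⟩ else c
  -- The filler choice needs a direction; without one `Ω` would be empty, against total mass one.
  by_cases hd : IsEmpty (Fin d)
  · have : IsEmpty Ω := ⟨fun ω => hd.elim (S [] ω).1⟩
    have : P = 0 := Measure.eq_zero_of_isEmpty P
    exact absurd this (IsProbabilityMeasure.ne_zero P)
  rw [not_isEmpty_iff] at hd
  obtain ⟨i⟩ := hd
  have hextend : Measurable (extend (i, true)) := by
    refine measurable_pi_lambda _ fun w => ?_
    by_cases hw : w.length ∈ Finset.range p
    · simp only [extend, hw, dif_pos]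
      exact measurable_pi_apply _
    · simp only [extend, hw]
      exact measurable_const
  have hψ : Measurable fun t : ({p} : Finset ℕ) → Fin d × Bool => t ⟨p, by simp⟩ :=
    measurable_pi_apply _
  have h2 := h.comp (φ := fun t => cell opt (extend (i, true) t) (branch b p))
    (ψ := fun t => t ⟨p, by simp⟩) ((measurable_cell opt _).comp hextend) hψ
  convert h2 using 1
  swap
  · rfl
  funext ω
  refine cell_congr b p fun k hk => ?_
  have : ∀ w : List Bool, w.length = k → (∀ hw : w.length ∈ Finset.range p,
      S (branch b k) ω = S (branch b (⟨w.length, hw⟩ : Finset.range p)) ω) := by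
    rintro w rfl hw
    rfl
  have hl : (branch b k).length ∈ Finset.range p := by rw [length_branch]; simpa using hk
  simp only [extend, dif_pos hl]
  exact this _ (length_branch b k) hl

lemma IsSplittingStrategy.lintegral_shrink (hS : IsSplittingStrategy P q S) (v : List Bool)
    (j : Fin d) :
    ∫⁻ ω, shrink j (S v ω) ∂P = 1 - ENNReal.ofReal (q / d) / 2 := by
  have hset : MeasurableSet {ω | S v ω = (j, true)} := hS.measurable v (measurableSet_singleton _)
  have hP : P {ω | S v ω = (j, true)} = ENNReal.ofReal (q / d) := by
    rw [← hS.prob_mid v j, ofReal_measureReal]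
  have hm : Measurable fun ω => shrink j (S v ω) :=
    (measurable_of_countable (shrink j)).comp (hS.measurable v)
  -- Adding `1/2` on the midpoint event turns `shrink` into the constant `1`.
  have h1 : ∫⁻ ω, (shrink j (S v ω) + {ω | S v ω = (j, true)}.indicator (fun _ => 2⁻¹) ω) ∂P
      = 1 := by
    rw [← measure_univ (μ := P), ← lintegral_one]
    refine lintegral_congr fun ω => ?_
    by_cases h : S v ω = (j, true) <;> simp [shrink, h, ENNReal.inv_two_add_inv_two]
  rw [lintegral_add_left hm, lintegral_indicator_const hset, hP] at h1
  rw [div_eq_mul_inv, mul_comm]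
  exact ENNReal.eq_sub_of_add_eq (by finiteness) h1

lemma IsSplittingStrategy.lintegral_leafSide_le (hS : IsSplittingStrategy P q S)
    (hopt : IsAdmissible opt) (j : Fin d) (x : Fin d → ℝ) (p : ℕ) :
    ∫⁻ ω, leafSide opt j p (fun v => S v ω) x ∂P ≤ (1 - ENNReal.ofReal (q / d) / 2) ^ p := by
  have hSm : Measurable fun ω v => S v ω := measurable_pi_lambda _ hS.measurable
  have hc : ∀ v, Measurable fun ω => cell opt (fun w => S w ω) v := fun v =>
    (measurable_cell opt v).comp hSm
  have hside : ∀ v, Measurable fun ω => sideAt j (cell opt (fun w => S w ω) v) x := fun v =>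
    (measurable_from_top (f := fun Q => sideAt j Q x)).comp (hc v)
  have hshr : ∀ v, Measurable fun ω => shrink j (S v ω) := fun v =>
    (measurable_of_countable (shrink j)).comp (hS.measurable v)
  induction p with
  | zero =>
    refine (lintegral_mono fun ω => leafSide_zero_le j _ x).trans ?_
    simp
  | succ p ih =>
    calc ∫⁻ ω, leafSide opt j (p + 1) (fun v => S v ω) x ∂P
        ≤ ∫⁻ ω, ∑ v : Fin p → Bool, sideAt j (cell opt (fun w => S w ω) (List.ofFn v)) x
            * shrink j (S (List.ofFn v) ω) ∂P :=
          lintegral_mono fun ω => leafSide_succ_le hopt j p _ x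
      _ = ∑ v : Fin p → Bool, (∫⁻ ω, sideAt j (cell opt (fun w => S w ω) (List.ofFn v)) x ∂P)
            * (1 - ENNReal.ofReal (q / d) / 2) := by
          rw [lintegral_finsetSum _ fun v _ => by exact (hside _).mul (hshr _)]
          refine Finset.sum_congr rfl fun v _ => ?_
          rw [← hS.lintegral_shrink (List.ofFn v) j]
          exact lintegral_mul_eq_lintegral_mul_lintegral_of_indepFun (hside _) (hshr _)
            ((hS.indepFun_cell opt (List.ofFn v)).comp
              (measurable_from_top (f := fun Q => sideAt j Q x))
              (measurable_of_countable (shrink j)))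
      _ = (∫⁻ ω, leafSide opt j p (fun v => S v ω) x ∂P)
            * (1 - ENNReal.ofReal (q / d) / 2) := by
          rw [← Finset.sum_mul, ← lintegral_finsetSum _ fun v _ => hside _]
          rfl
      _ ≤ _ := by
          rw [pow_succ]
          gcongr

end Shrinking

/-! ### Cell averaging contracts `L²`. -/

section Contraction

lemma eLpNorm_two_sq {α : Type*} [MeasurableSpace α] (μ : Measure α) (f : α → ℝ) :
    eLpNorm f 2 μ ^ 2 = ∫⁻ x, ‖f x‖ₑ ^ 2 ∂μ := by
  simpa using eLpNorm_nnreal_pow_eq_lintegral (f := f) (μ := μ) (p := 2) two_ne_zero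

/-- The `L¹` norm is at most the `L²` norm for the normalized restriction of `μ` to `A`. -/
lemma enorm_setAverage_sq_mul_le {α : Type*} [MeasurableSpace α] {μ : Measure α}
    [IsFiniteMeasure μ] {f : α → ℝ} (hf : AEStronglyMeasurable f μ) (A : Set α) :
    ‖⨍ x in A, f x ∂μ‖ₑ ^ 2 * μ A ≤ ∫⁻ x in A, ‖f x‖ₑ ^ 2 ∂μ := by
  by_cases hA : μ A = 0
  · simp [hA]
  have hA' : μ A ≠ ∞ := measure_ne_top μ A
  have hprob : IsProbabilityMeasure ((μ A)⁻¹ • μ.restrict A) :=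
    ⟨by simp [ENNReal.inv_mul_cancel hA hA']⟩
  have hfA : AEStronglyMeasurable f ((μ A)⁻¹ • μ.restrict A) := hf.restrict.smul_measure _
  have h1 : ‖⨍ x in A, f x ∂μ‖ₑ ≤ eLpNorm f 2 ((μ A)⁻¹ • μ.restrict A) := by
    rw [setAverage_eq']
    refine (enorm_integral_le_lintegral_enorm f).trans ?_
    rw [← eLpNorm_one_eq_lintegral_enorm]
    exact eLpNorm_le_eLpNorm_of_exponent_le one_le_two hfA
  calc ‖⨍ x in A, f x ∂μ‖ₑ ^ 2 * μ A
      ≤ eLpNorm f 2 ((μ A)⁻¹ • μ.restrict A) ^ 2 * μ A := by gcongr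
    _ = ∫⁻ x in A, ‖f x‖ₑ ^ 2 ∂μ := by
        rw [eLpNorm_two_sq, lintegral_smul_measure, smul_eq_mul, mul_comm, ← mul_assoc,
          ENNReal.mul_inv_cancel hA hA', one_mul]

variable {d : ℕ} {opt : List Bool → Box d → Fin d → ℝ} {s : List Bool → Fin d × Bool}

lemma tree_eq_of_mem (hopt : IsAdmissible opt) {Ω : Type*} [MeasurableSpace Ω] (P : Measure Ω)
    (X : Ω → Fin d → ℝ) (Y : Ω → ℝ) {p : ℕ} {v : Fin p → Bool} {x : Fin d → ℝ}
    (hx : x ∈ (cell opt s (List.ofFn v)).toSet) :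
    tree P X Y opt p s x = cellMean P X Y (cell opt s (List.ofFn v)).toSet := by
  unfold tree
  rw [Finset.sum_eq_single v, Set.indicator_of_mem hx]
  · intro w _ hw
    exact Set.indicator_of_notMem
      (fun hxw => Set.disjoint_left.1 (pairwise_disjoint_cell hopt s p hw) hxw hx) _
  · simp

lemma enorm_tree_sq_le (hopt : IsAdmissible opt) {Ω : Type*} [MeasurableSpace Ω] (P : Measure Ω)
    (X : Ω → Fin d → ℝ) (Y : Ω → ℝ) (p : ℕ) (x : Fin d → ℝ) :
    ‖tree P X Y opt p s x‖ₑ ^ 2 ≤ ∑ v : Fin p → Bool,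
      (cell opt s (List.ofFn v)).toSet.indicator
        (fun _ => ‖cellMean P X Y (cell opt s (List.ofFn v)).toSet‖ₑ ^ 2) x := by
  by_cases hx : ∃ v : Fin p → Bool, x ∈ (cell opt s (List.ofFn v)).toSet
  · obtain ⟨v, hv⟩ := hx
    rw [tree_eq_of_mem hopt P X Y hv]
    refine le_trans ?_ (Finset.single_le_sum (fun _ _ => zero_le) (Finset.mem_univ v))
    rw [Set.indicator_of_mem hv]
  · push Not at hx
    have : tree P X Y opt p s x = 0 :=
      Finset.sum_eq_zero fun v _ => Set.indicator_of_notMem (hx v) _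
    simp [this]

variable {μ : Measure (Fin d → ℝ)} [IsFiniteMeasure μ]

/-- For fixed choices, passing from a function to its regression tree is an `L²` contraction. -/
lemma lintegral_tree_sq_le (hopt : IsAdmissible opt) (s : List Bool → Fin d × Bool) (p : ℕ)
    {f : (Fin d → ℝ) → ℝ} (hf : AEStronglyMeasurable f μ) :
    ∫⁻ x, ‖tree μ id f opt p s x‖ₑ ^ 2 ∂μ ≤ ∫⁻ x, ‖f x‖ₑ ^ 2 ∂μ := by
  have hm := fun v : Fin p → Bool => (cell opt s (List.ofFn v)).measurableSet_toSet
  calc ∫⁻ x, ‖tree μ id f opt p s x‖ₑ ^ 2 ∂μ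
      ≤ ∫⁻ x, ∑ v : Fin p → Bool, (cell opt s (List.ofFn v)).toSet.indicator
          (fun _ => ‖cellMean μ id f (cell opt s (List.ofFn v)).toSet‖ₑ ^ 2) x ∂μ :=
        lintegral_mono fun x => enorm_tree_sq_le hopt μ id f p x
    _ = ∑ v : Fin p → Bool, ‖cellMean μ id f (cell opt s (List.ofFn v)).toSet‖ₑ ^ 2
          * μ (cell opt s (List.ofFn v)).toSet := by
        rw [lintegral_finsetSum _ fun v _ => measurable_const.indicator (hm v)]
        exact Finset.sum_congr rfl fun v _ => lintegral_indicator_const (hm v) _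
    _ ≤ ∑ v : Fin p → Bool, ∫⁻ x in (cell opt s (List.ofFn v)).toSet, ‖f x‖ₑ ^ 2 ∂μ :=
        Finset.sum_le_sum fun v _ => enorm_setAverage_sq_mul_le hf _
    _ = ∫⁻ x in ⋃ v : Fin p → Bool, (cell opt s (List.ofFn v)).toSet, ‖f x‖ₑ ^ 2 ∂μ := by
        rw [lintegral_iUnion hm (pairwise_disjoint_cell hopt s p), tsum_fintype]
    _ ≤ _ := setLIntegral_le_lintegral _ _

-- `opt` and `s` are held fixed, so all three functions are averaged over the same cells.
omit [IsFiniteMeasure μ] in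
lemma tree_sub {f g : (Fin d → ℝ) → ℝ} (hf : Integrable f μ) (hg : Integrable g μ) (p : ℕ)
    (x : Fin d → ℝ) :
    tree μ id (f - g) opt p s x = tree μ id f opt p s x - tree μ id g opt p s x := by
  unfold tree
  rw [← Finset.sum_sub_distrib]
  refine Finset.sum_congr rfl fun v _ => ?_
  have : ∀ A : Set (Fin d → ℝ), cellMean μ id (f - g) A = cellMean μ id f A - cellMean μ id g A := by
    intro A
    simp only [cellMean, setAverage_eq, Set.preimage_id, Pi.sub_apply,
      integral_sub hf.integrableOn hg.integrableOn, smul_sub]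
  rw [this]
  by_cases hx : x ∈ (cell opt s (List.ofFn v)).toSet <;> simp [hx]

variable {ν : Measure (List Bool → Fin d × Bool)} [IsProbabilityMeasure ν]

lemma eLpNorm_tree_le (hopt : IsAdmissible opt) (p : ℕ) {f : (Fin d → ℝ) → ℝ}
    (hf : AEStronglyMeasurable f μ) :
    eLpNorm (fun z : (List Bool → Fin d × Bool) × (Fin d → ℝ) => tree μ id f opt p z.1 z.2) 2
      (ν.prod μ) ≤ eLpNorm f 2 μ := by
  rw [← ENNReal.pow_le_pow_left_iff two_ne_zero, eLpNorm_two_sq, eLpNorm_two_sq,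
    lintegral_prod _ ((measurable_tree μ id f p).enorm.pow_const 2).aemeasurable]
  refine (lintegral_mono fun s => lintegral_tree_sq_le hopt s p hf).trans ?_
  simp

end Contraction

/-! ### Convergence for continuous functions, then by density. -/

section Approximation

variable {d : ℕ} {opt : List Bool → Box d → Fin d → ℝ} {μ : Measure (Fin d → ℝ)}
  [IsProbabilityMeasure μ]

lemma norm_cellMean_sub_le {g : (Fin d → ℝ) → ℝ} (hg : Integrable g μ) {A : Set (Fin d → ℝ)}
    (hAm : MeasurableSet A) (hA : μ A ≠ 0) (c : ℝ) {ε : ℝ} (h : ∀ y ∈ A, ‖g y - c‖ ≤ ε) :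
    ‖cellMean μ id g A - c‖ ≤ ε := by
  have := (convex_closedBall c ε).set_average_mem Metric.isClosed_closedBall hA
    (measure_ne_top μ A) (ae_restrict_of_forall_mem hAm fun y hy => by
      rw [mem_closedBall_iff_norm]; exact h y hy) hg.integrableOn
  rwa [mem_closedBall_iff_norm] at this

-- On a null cell the mean defaults to `0`, possibly far from `g`; there are only countably many
-- nodes to exclude.
omit [IsProbabilityMeasure μ] in
lemma ae_forall_cell_ne_zero (opt : List Bool → Box d → Fin d → ℝ)
    (s : List Bool → Fin d × Bool) :
    ∀ᵐ x ∂μ, ∀ v : List Bool, x ∈ (cell opt s v).toSet → μ (cell opt s v).toSet ≠ 0 := by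
  rw [ae_all_iff]
  intro v
  by_cases h : μ (cell opt s v).toSet = 0
  · filter_upwards [measure_eq_zero_iff_ae_notMem.1 h] with x hx hx'
    exact absurd hx' hx
  · exact ae_of_all _ fun _ _ => h

/-- The regression tree of a uniformly continuous function is close to the function at the points
whose cell is small. -/
lemma enorm_tree_sub_sq_le (hopt : IsAdmissible opt) {g : (Fin d → ℝ) → ℝ} (hg : Integrable g μ)
    {C δ ε : ℝ} (hC : ∀ x, ‖g x‖ ≤ C) (hδ : 0 < δ)
    (hgδ : ∀ x y, dist x y < δ → dist (g x) (g y) < ε) (p : ℕ) {s : List Bool → Fin d × Bool}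
    {x : Fin d → ℝ} (hx : x ∈ (Box.unit d).toSet)
    (hpos : ∀ v : List Bool, x ∈ (cell opt s v).toSet → μ (cell opt s v).toSet ≠ 0) :
    ‖tree μ id g opt p s x - g x‖ₑ ^ 2 ≤ ENNReal.ofReal ε ^ 2
      + ENNReal.ofReal (2 * C) ^ 2 / ENNReal.ofReal δ * ∑ j, leafSide opt j p s x := by
  obtain ⟨v, hv⟩ := exists_mem_cell (s := s) hopt hx p
  have hAm := (cell opt s (List.ofFn v)).measurableSet_toSet
  rw [tree_eq_of_mem hopt μ id g hv]
  by_cases hside : ∀ j, (cell opt s (List.ofFn v)).side j ≤ δ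
  · refine le_trans ?_ le_self_add
    gcongr
    rw [← ofReal_norm]
    refine ENNReal.ofReal_le_ofReal (norm_cellMean_sub_le hg hAm (hpos _ hv) _ fun y hy => ?_)
    rw [← dist_eq_norm]
    exact (hgδ y x (dist_lt_of_mem_toSet hδ hside hy hv)).le
  · push Not at hside
    obtain ⟨j, hj⟩ := hside
    refine le_trans ?_ le_add_self
    have h1 : ‖cellMean μ id g (cell opt s (List.ofFn v)).toSet - g x‖ₑ
        ≤ ENNReal.ofReal (2 * C) := by
      rw [← ofReal_norm]
      refine ENNReal.ofReal_le_ofReal (norm_cellMean_sub_le hg hAm (hpos _ hv) _ fun y _ => ?_)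
      linarith [norm_sub_le (g y) (g x), hC y, hC x]
    -- Markov's argument: one side longer than `δ` makes the sum over `δ` at least `1`, which pays
    -- for the trivial bound `2C`.
    have h2 : ENNReal.ofReal δ ≤ ∑ j, leafSide opt j p s x := by
      refine le_trans ?_ (Finset.single_le_sum (f := fun j => leafSide opt j p s x)
        (fun _ _ => zero_le) (Finset.mem_univ j))
      refine le_trans ?_ (sideAt_le_leafSide j v x)
      rw [sideAt, Set.indicator_of_mem hv]
      exact ENNReal.ofReal_le_ofReal hj.le
    calc _ ≤ ENNReal.ofReal (2 * C) ^ 2 := by gcongr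
      _ = ENNReal.ofReal (2 * C) ^ 2 / ENNReal.ofReal δ * ENNReal.ofReal δ :=
        (ENNReal.div_mul_cancel (by simpa using hδ) ENNReal.ofReal_ne_top).symm
      _ ≤ _ := by gcongr

variable {ν : Measure (List Bool → Fin d × Bool)} [IsProbabilityMeasure ν]

lemma lintegral_tree_sub_sq_le (hopt : IsAdmissible opt)
    (hμ : ∀ᵐ x ∂μ, x ∈ (Box.unit d).toSet)
    {r : ℝ≥0∞} {p : ℕ} (hν : ∀ j x, ∫⁻ s, leafSide opt j p s x ∂ν ≤ r ^ p)
    {g : (Fin d → ℝ) → ℝ} (hgm : Measurable g) (hg : Integrable g μ)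
    {C δ ε : ℝ} (hC : ∀ x, ‖g x‖ ≤ C) (hδ : 0 < δ)
    (hgδ : ∀ x y, dist x y < δ → dist (g x) (g y) < ε) :
    ∫⁻ z, ‖tree μ id g opt p z.1 z.2 - g z.2‖ₑ ^ 2 ∂(ν.prod μ) ≤ ENNReal.ofReal ε ^ 2
      + ENNReal.ofReal (2 * C) ^ 2 / ENNReal.ofReal δ * (d * r ^ p) := by
  have hm : Measurable fun z : (List Bool → Fin d × Bool) × (Fin d → ℝ) =>
      ∑ j, leafSide opt j p z.1 z.2 := Finset.measurable_sum _ fun j _ => measurable_leafSide j p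
  calc ∫⁻ z, ‖tree μ id g opt p z.1 z.2 - g z.2‖ₑ ^ 2 ∂(ν.prod μ)
      = ∫⁻ s, ∫⁻ x, ‖tree μ id g opt p s x - g x‖ₑ ^ 2 ∂μ ∂ν :=
        lintegral_prod _ (((measurable_tree μ id g p).sub
          (hgm.comp measurable_snd)).enorm.pow_const 2).aemeasurable
    _ ≤ ∫⁻ s, ∫⁻ x, (ENNReal.ofReal ε ^ 2 + ENNReal.ofReal (2 * C) ^ 2 / ENNReal.ofReal δ
          * ∑ j, leafSide opt j p s x) ∂μ ∂ν := by
        refine lintegral_mono fun s => lintegral_mono_ae ?_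
        filter_upwards [hμ, ae_forall_cell_ne_zero opt s] with x hx hpos
        exact enorm_tree_sub_sq_le hopt hg hC hδ hgδ p hx hpos
    _ = ∫⁻ z, (ENNReal.ofReal ε ^ 2 + ENNReal.ofReal (2 * C) ^ 2 / ENNReal.ofReal δ
          * ∑ j, leafSide opt j p z.1 z.2) ∂(ν.prod μ) :=
        (lintegral_prod _ (measurable_const.add (hm.const_mul _)).aemeasurable).symm
    _ = ENNReal.ofReal ε ^ 2 + ENNReal.ofReal (2 * C) ^ 2 / ENNReal.ofReal δ
          * ∑ j, ∫⁻ x, ∫⁻ s, leafSide opt j p s x ∂ν ∂μ := by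
        rw [lintegral_add_left measurable_const, lintegral_const_mul _ hm,
          lintegral_finsetSum _ fun j _ => measurable_leafSide j p]
        simp only [lintegral_const, measure_univ, mul_one]
        congr 2
        -- Tonelli: the decay bound averages over the choices at a fixed `x`.
        exact Finset.sum_congr rfl fun j _ =>
          lintegral_prod_symm _ (measurable_leafSide j p).aemeasurable
    _ ≤ ENNReal.ofReal ε ^ 2 + ENNReal.ofReal (2 * C) ^ 2 / ENNReal.ofReal δ
          * ∑ _j : Fin d, r ^ p := by
        gcongr with j
        refine (lintegral_mono fun x => hν j x).trans ?_
        simp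
    _ = _ := by simp

/-- `L²` consistency of the random trees for the law `ν` of the choices and the law `μ` of the
point, as soon as the expected side lengths of the cells decay geometrically. -/
lemma tendsto_eLpNorm_tree_sub (hopt : IsAdmissible opt)
    (hμ : ∀ᵐ x ∂μ, x ∈ (Box.unit d).toSet) {r : ℝ≥0∞} (hr : r < 1)
    (hν : ∀ p j x, ∫⁻ s, leafSide opt j p s x ∂ν ≤ r ^ p)
    {f : (Fin d → ℝ) → ℝ} (hf : MemLp f 2 μ) :
    Tendsto (fun p => eLpNorm (fun z : (List Bool → Fin d × Bool) × (Fin d → ℝ) =>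
      tree μ id f opt p z.1 z.2 - f z.2) 2 (ν.prod μ)) atTop (𝓝 0) := by
  rw [ENNReal.tendsto_nhds_zero]
  intro η hη
  -- The budget `4ε` is `ε` for the tree of `f - g`, `2ε` for the error on `g` (as `ε² + ε² ≤
  -- (2ε)²`), and `ε` for `f - g`.
  obtain ⟨ε, hε, hεη⟩ : ∃ ε : ℝ, 0 < ε ∧ 4 * ENNReal.ofReal ε ≤ η := by
    obtain ⟨e, he, heη⟩ := ENNReal.lt_iff_exists_nnreal_btwn.1 hη
    refine ⟨e / 4, by simpa using he, le_trans (le_of_eq ?_) heη.le⟩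
    rw [← ENNReal.ofReal_ofNat, ← ENNReal.ofReal_mul (by norm_num)]
    rw [mul_div_cancel₀ _ (by norm_num : (4 : ℝ) ≠ 0), ENNReal.ofReal_coe_nnreal]
  have hε' : ENNReal.ofReal ε ≠ 0 := by simpa using hε
  obtain ⟨g, hgs, hfg, hgc, hg2⟩ := hf.exists_hasCompactSupport_eLpNorm_sub_le
    ENNReal.ofNat_ne_top hε'
  obtain ⟨C, hC⟩ := hgs.exists_bound_of_continuous hgc
  obtain ⟨δ, hδ, hgδ⟩ := Metric.uniformContinuous_iff.1
    (hgs.uniformContinuous_of_continuous hgc) ε hε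
  have hlim : Tendsto (fun p : ℕ => ENNReal.ofReal (2 * C) ^ 2 / ENNReal.ofReal δ * (d * r ^ p))
      atTop (𝓝 0) := by
    have hK : ENNReal.ofReal (2 * C) ^ 2 / ENNReal.ofReal δ ≠ ∞ :=
      ENNReal.div_ne_top (by finiteness) (by simpa using hδ)
    have h0 := ENNReal.tendsto_pow_atTop_nhds_zero_of_lt_one hr
    simpa using ENNReal.Tendsto.const_mul
      (ENNReal.Tendsto.const_mul h0 (Or.inr (ENNReal.natCast_ne_top d))) (Or.inr hK)
  filter_upwards [ENNReal.tendsto_nhds_zero.1 hlim (ENNReal.ofReal ε ^ 2)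
    (pos_iff_ne_zero.2 (pow_ne_zero 2 hε'))] with p hp
  have hfi := hf.integrable one_le_two
  have hgi := hg2.integrable one_le_two
  have hmid : eLpNorm (fun z : (List Bool → Fin d × Bool) × (Fin d → ℝ) =>
      tree μ id g opt p z.1 z.2 - g z.2) 2 (ν.prod μ) ≤ 2 * ENNReal.ofReal ε := by
    rw [← ENNReal.pow_le_pow_left_iff two_ne_zero, eLpNorm_two_sq]
    refine (lintegral_tree_sub_sq_le hopt hμ (hν p) hgc.measurable hgi hC hδ
      fun x y h => hgδ h).trans ((add_le_add_right hp _).trans ?_)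
    rw [mul_pow, ← two_mul]
    gcongr
    norm_num
  have hdiff : AEStronglyMeasurable (f - g) μ := (hf.sub hg2).1
  have hdec : (fun z : (List Bool → Fin d × Bool) × (Fin d → ℝ) =>
      tree μ id f opt p z.1 z.2 - f z.2)
      = ((fun z => tree μ id (f - g) opt p z.1 z.2) + fun z => tree μ id g opt p z.1 z.2 - g z.2)
        - fun z => (f - g) z.2 := by
    funext z
    simp only [Pi.add_apply, Pi.sub_apply, tree_sub hfi hgi]
    ring
  have hsnd : eLpNorm (fun z : (List Bool → Fin d × Bool) × (Fin d → ℝ) => (f - g) z.2) 2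
      (ν.prod μ) = eLpNorm (f - g) 2 μ :=
    eLpNorm_comp_measurePreserving hdiff measurePreserving_snd
  have m1 := (measurable_tree (opt := opt) μ id (f - g) p).aestronglyMeasurable (μ := ν.prod μ)
  have m2 := ((measurable_tree (opt := opt) μ id g p).sub
    (hgc.measurable.comp measurable_snd)).aestronglyMeasurable (μ := ν.prod μ)
  rw [hdec]
  calc _ ≤ eLpNorm (fun z : (List Bool → Fin d × Bool) × (Fin d → ℝ) =>
            tree μ id (f - g) opt p z.1 z.2) 2 (ν.prod μ)
          + eLpNorm (fun z : (List Bool → Fin d × Bool) × (Fin d → ℝ) =>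
            tree μ id g opt p z.1 z.2 - g z.2) 2 (ν.prod μ)
          + eLpNorm (fun z : (List Bool → Fin d × Bool) × (Fin d → ℝ) => (f - g) z.2) 2
            (ν.prod μ) :=
        (eLpNorm_sub_le (m1.add m2) (hdiff.comp_measurePreserving measurePreserving_snd)
          one_le_two).trans (add_le_add_left (eLpNorm_add_le m1 m2 one_le_two) _)
    _ ≤ ENNReal.ofReal ε + 2 * ENNReal.ofReal ε + ENNReal.ofReal ε := by
        rw [hsnd]
        exact add_le_add (add_le_add ((eLpNorm_tree_le hopt p hdiff).trans hfg) hmid) hfg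
    _ = 4 * ENNReal.ofReal ε := by ring
    _ ≤ η := hεη

end Approximation

/-! ### From `(X, Y)` to the law of `X`. -/

section Transfer

variable {Ω : Type*} [MeasurableSpace Ω] {P : Measure Ω} {d : ℕ} {X : Ω → Fin d → ℝ} {Y : Ω → ℝ}

lemma IsOptimalRule.isAdmissible {opt : List Bool → Box d → Fin d → ℝ}
    (hopt : IsOptimalRule P X Y opt) : IsAdmissible opt :=
  fun v Q j hQ => (hopt v Q j hQ).1

/-- The cell means of `Y` are those of any version `f` of its regression function, under the law
of `X`. -/
lemma cellMean_eq_of_condExp_eq [IsFiniteMeasure P] (hX : Measurable X) (hY : Integrable Y P)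
    {f : (Fin d → ℝ) → ℝ} (hf : Measurable f)
    (hfY : P[Y | MeasurableSpace.comap X inferInstance] = f ∘ X)
    {A : Set (Fin d → ℝ)} (hA : MeasurableSet A) :
    cellMean P X Y A = cellMean (P.map X) id f A := by
  simp only [cellMean, setAverage_eq, Set.preimage_id]
  rw [setIntegral_map hA hf.aestronglyMeasurable hX.aemeasurable, measureReal_def,
    measureReal_def, Measure.map_apply hX hA, ← setIntegral_condExp hX.comap_le hY ⟨A, hA, rfl⟩,
    hfY]
  rfl

/-- The density makes the upper faces, absent from the half-open root cell, negligible. -/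
lemma ae_map_mem_unit (hX : Measurable X) (hXcube : ∀ ω, X ω ∈ Set.Icc 0 1)
    (hXpdf : HasPDF X P volume) : ∀ᵐ x ∂(P.map X), x ∈ (Box.unit d).toSet := by
  have h1 : ∀ᵐ x ∂(P.map X), x ∈ Set.Icc (0 : Fin d → ℝ) 1 :=
    (ae_map_iff hX.aemeasurable measurableSet_Icc).2 (ae_of_all _ hXcube)
  have h2 : (Box.unit d).toSet =ᵐ[volume] Set.Icc (0 : Fin d → ℝ) 1 :=
    Measure.univ_pi_Ico_ae_eq_Icc
  filter_upwards [h1, HasPDF.absolutelyContinuous.ae_le h2.mem_iff] with x hx hx'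
  exact hx'.2 hx

end Transfer

end RegTree

end

theorem theorem4p2 {Ω : Type*} [MeasurableSpace Ω] (P : Measure Ω) [IsProbabilityMeasure P]
    (d : ℕ) (hd : 1 ≤ d)
    (X : Ω → Fin d → ℝ) (hX : Measurable X) (hXcube : ∀ ω, X ω ∈ Set.Icc 0 1)
    (hXpdf : HasPDF X P volume)
    (Y : Ω → ℝ) (hY : Measurable Y) (hY2 : MemLp Y 2 P)
    (q : ℝ) (hq0 : 0 < q) (hq1 : q < 1)
    (S : List Bool → Ω → Fin d × Bool) (hS : RegTree.IsSplittingStrategy P q S)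
    (hSXY : IndepFun (fun ω v => S v ω) (fun ω => (X ω, Y ω)) P)
    (opt : List Bool → RegTree.Box d → Fin d → ℝ) (hopt : RegTree.IsOptimalRule P X Y opt) :
    (∀ p : ℕ, MemLp (fun ω => RegTree.tree P X Y opt p (fun v => S v ω) (X ω)) 2 P) ∧
    Tendsto
      (fun p : ℕ => ∫ ω, |RegTree.tree P X Y opt p (fun v => S v ω) (X ω)
        - (P[Y | MeasurableSpace.comap X inferInstance]) ω| ^ 2 ∂P)
      atTop (𝓝 0) := by
  have hadm := hopt.isAdmissible
  -- Doob–Dynkin: a `σ(X)`-measurable function factors through `X`.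
  obtain ⟨f, hfm, hfX⟩ := (stronglyMeasurable_condExp (μ := P) (f := Y)
    (m := MeasurableSpace.comap X inferInstance)).measurable.exists_eq_measurable_comp
  have hSm : Measurable fun ω v => S v ω := measurable_pi_lambda _ hS.measurable
  have hSX : Measurable fun ω => ((fun v => S v ω), X ω) := hSm.prodMk hX
  set μ := P.map X with hμ
  set ν := P.map fun ω v => S v ω with hν
  have : IsProbabilityMeasure μ := Measure.isProbabilityMeasure_map hX.aemeasurable
  have : IsProbabilityMeasure ν := Measure.isProbabilityMeasure_map hSm.aemeasurable
  have hprod : P.map (fun ω => ((fun v => S v ω), X ω)) = ν.prod μ :=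
    (indepFun_iff_map_prod_eq_prod_map_map hSm.aemeasurable hX.aemeasurable).1
      (hSXY.comp measurable_id measurable_fst)
  have hZ : MemLp (f ∘ X) 2 P := hfX ▸ hY2.condExp one_le_two
  have hf : MemLp f 2 μ := (memLp_map_measure_iff hfm.aestronglyMeasurable hX.aemeasurable).2 hZ
  have htree : ∀ p s x, RegTree.tree P X Y opt p s x = RegTree.tree μ id f opt p s x := by
    intro p s x
    unfold RegTree.tree
    simp only [RegTree.cellMean_eq_of_condExp_eq hX (hY2.integrable one_le_two) hfm hfX
      (RegTree.Box.measurableSet_toSet _), hμ]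
  have hside : ∀ p j x, ∫⁻ s, RegTree.leafSide opt j p s x ∂ν
      ≤ (1 - ENNReal.ofReal (q / d) / 2) ^ p := by
    intro p j x
    rw [hν, lintegral_map (RegTree.measurable_leafSide_left j p x) hSm]
    exact hS.lintegral_leafSide_le hadm j x p
  have hr : 1 - ENNReal.ofReal (q / d) / 2 < 1 := by
    refine ENNReal.sub_lt_self ENNReal.one_ne_top one_ne_zero ?_
    have : 0 < q / d := div_pos hq0 (by exact_mod_cast hd)
    simpa using this
  have hlim := RegTree.tendsto_eLpNorm_tree_sub (μ := μ) (ν := ν) hadm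
    (RegTree.ae_map_mem_unit hX hXcube hXpdf) hr hside hf
  have hmT := fun p => RegTree.measurable_tree (opt := opt) μ id f p
  have hmeas : ∀ p, Measurable fun z : (List Bool → Fin d × Bool) × (Fin d → ℝ) =>
      RegTree.tree μ id f opt p z.1 z.2 - f z.2 := fun p => (hmT p).sub (hfm.comp measurable_snd)
  constructor
  · intro p
    simp only [htree]
    have : MemLp (fun z : (List Bool → Fin d × Bool) × (Fin d → ℝ) =>
        RegTree.tree μ id f opt p z.1 z.2) 2 (ν.prod μ) :=
      ⟨(hmT p).aestronglyMeasurable, (RegTree.eLpNorm_tree_le hadm p hf.1).trans_lt hf.2⟩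
    rw [← hprod] at this
    exact this.comp_of_map hSX.aemeasurable
  · have hint : ∀ p, ∫ ω, |RegTree.tree P X Y opt p (fun v => S v ω) (X ω)
        - (P[Y | MeasurableSpace.comap X inferInstance]) ω| ^ 2 ∂P
        = (eLpNorm (fun z : (List Bool → Fin d × Bool) × (Fin d → ℝ) =>
          RegTree.tree μ id f opt p z.1 z.2 - f z.2) 2 (ν.prod μ) ^ 2).toReal := by
      intro p
      rw [RegTree.eLpNorm_two_sq, ← hprod, lintegral_map ((hmeas p).enorm.pow_const 2) hSX, hfX,
        integral_eq_lintegral_of_nonneg_ae (ae_of_all _ fun ω => by positivity)]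
      · congr 1
        refine lintegral_congr fun ω => ?_
        rw [htree, ENNReal.ofReal_pow (abs_nonneg _), ← Real.norm_eq_abs, ofReal_norm]
        rfl
      · simp only [htree]
        exact (((hmeas p).comp hSX).norm.pow_const 2).aestronglyMeasurable
    simp only [hint]
    simpa [Function.comp_def] using (ENNReal.tendsto_toReal (by simp)).comp (ENNReal.Tendsto.pow hlim (n := 2))
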